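/- Let $n\ge 2$ and let $\tau$ be a plane binary tree (every vertex has degree $1$ or $3$) with $n$ leaves, rooted at a leaf, so that $\tau$ has $2n-3$ edges. An \emph{allowed angle assignment} on $\tau$ gives each corner of each inner vertex an angle in $(0,\pi)$ such that the three angles at each inner vertex sum to $2\pi$ and, for each inner edge, the two angles opposite to that edge have sum larger than $\pi$. It determines positive numbers $(\lambda_e)$ on the edges, up to a common factor, by the law of sines: at each inner vertex, with incident edges $e_1,e_2,e_3$ and opposite angles $\theta_1,\theta_2,\theta_3$, one has $\lambda_{e_1}/\sin\theta_1=\lambda_{e_2}/\sin\theta_2=\lambda_{e_3}/\sin\theta_3$. Define the label $\ell(e)$ by $\lambda_e=\sqrt{2e^{\ell(e)}}$, normalized by $\ell=0$ on the edge incident to the root leaf. Let $\mathrm{Glue}(\boldsymbol\tau)$ be the hyperbolic sphere with $n+1$ punctures encoded by $\boldsymbol\tau$ = ($\tau$ with its angles). To each inner vertex one associates an ideal hyperbolic triangle decorated with horocycles, whose sides correspond, in the cyclic order of the plane tree, to the three incident edges and have lambda-lengths the $\lambda_e$ of these edges. To each leaf, with incident edge $e$, one associates an ideal triangle with one side corresponding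 to $e$, whose other two sides are glued to each other so that they end at a puncture of the surface (a once-punctured monogon with boundary of lambda-length $\lambda_e$). The two sides corresponding to a same edge are glued so that the horocycles match. The ideal vertices other than those of the leaf punctures form one further puncture (the origin). Let $\mathrm d_{\mathrm{hyp}}$ be the hyperbolic distance on $\mathrm{Glue}(\boldsymbol\tau)$, and for a leaf $v$ let $\mathfrak c_v$ be the horocycle neighborhood, with boundary of length $1$, of the puncture associated with $v$; put $\mathrm d_{\mathrm{hyp}}(A,B)=\inf_{a\in A,\,b\in B}\mathrm d_{\mathrm{hyp}}(a,b)$ for sets $A,B$. A particle traces the contour of $\tau$ at unit speed during the time interval $[0,4n-6]$, starting from the root leaf and exploring left subtrees first. For $x\in[0,4n-6]$ let $\mathbf Z(x)$ be the label of the edge being visited at time $x$; when the particle is at a vertex, $\mathbf Z(x)$ is the label of one of the edges incident to that vertex, chosen arbitrarily once and for all for each vertex. Put $\mathbf Z^{(n)}(s)=n^{-1/4}\,\mathbf Z((4n-6)s)$ for $s\in[0,1]$. If at the times $(4n-6)s$ and $(4n-6)t$ the particle is at leaves $u$ and $v$ (the root leaf is allowed), put $D^{(n)}(s,t)=n^{-1/4}\,\mathrm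 d_{\mathrm{hyp}}(\mathfrak c_u,\mathfrak c_v)$. For a function $Z$ on $[0,1]$ whose minima below exist, let $$D^\circ_Z(s,t)=Z(s)+Z(t)-2\max\Big\{\min_{[s\wedge t,\,s\vee t]}Z\,;\ \min_{[0,\,s\wedge t]\cup[s\vee t,\,1]}Z\Big\}.$$ Then, for all $s,t\in[0,1]$ such that $(4n-6)s$ and $(4n-6)t$ are times at which the contour visits a leaf of $\tau$, $$D^{(n)}(s,t)\ \le\ \frac12\,D^\circ_{\mathbf Z^{(n)}}(s,t)+\frac{2\log n+10}{n^{1/4}}.$$ In particular this holds surely for the random surface $\mathcal S_n=\mathrm{Glue}(\boldsymbol T_n)$, where $\boldsymbol T_n$ is a random plane binary tree with $n$ leaves and an allowed angle assignment. -/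

import Mathlib

open Real UpperHalfPlane

noncomputable section

/-! ## Plane binary trees with angles -/

/-- A plane binary tree rooted on a leaf, whose inner vertices carry angles.

The root leaf itself is not recorded: `leaf` is the tree made of the root edge alone (so that its
upper end is the only other leaf), and `node α β l r` is the tree whose root edge leads to an inner
vertex with left subtree `l` and right subtree `r`. The three corners of that inner vertex carry, in
contour order, the angle `α` (between the edge to the parent and the edge to the left child),
`2π - α - β` (between the two children) and `β` (between the right child and the parent). -/
inductive AngleTree : Type
  | leaf : AngleTree
  | node (α β : ℝ) (l r : AngleTree) : AngleTree

namespace AngleTree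

/-- Number of leaves different from the root leaf. -/
def upperLeaves : AngleTree → ℕ
  | leaf => 1
  | node _ _ l r => l.upperLeaves + r.upperLeaves

/-- Number of leaves, including the root leaf. -/
def numLeaves (t : AngleTree) : ℕ := t.upperLeaves + 1

/-- The angle opposite to the root edge at its upper end; the angle at a leaf is `π`. -/
def oppAngle : AngleTree → ℝ
  | leaf => π
  | node α β _ _ => 2 * π - α - β

/-- Allowed angle assignments: at every inner vertex the three angles lie in `(0, π)` (their sum is
`2π` by construction), and for every inner edge the two angles opposite to it have sum larger
than `π`. (For edges ending at a leaf the latter holds automatically.) -/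
def Allowed : AngleTree → Prop
  | leaf => True
  | node α β l r =>
      α ∈ Set.Ioo 0 π ∧ β ∈ Set.Ioo 0 π ∧ 2 * π - α - β ∈ Set.Ioo 0 π ∧
      π < β + l.oppAngle ∧ π < α + r.oppAngle ∧ l.Allowed ∧ r.Allowed

/-- The vertices of the tree other than the root leaf. Each of them is also used to name the edge
that joins it to its parent, so that `Pos t` is the set of edges as well. -/
inductive Pos : AngleTree → Type
  | top (t : AngleTree) : Pos t
  | left {α β : ℝ} {l r : AngleTree} (p : Pos l) : Pos (node α β l r)
  | right {α β : ℝ} {l r : AngleTree} (p : Pos r) : Pos (node α β l r)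

/-- The vertices of the tree: `none` is the root leaf. -/
abbrev Vertex (t : AngleTree) : Type := Option (Pos t)

/-- `p` is a leaf (different from the root leaf). -/
def Pos.IsLeaf : {t : AngleTree} → Pos t → Prop
  | leaf, .top _ => True
  | node _ _ _ _, .top _ => False
  | _, .left p => p.IsLeaf
  | _, .right p => p.IsLeaf

/-- `v` is a leaf; the root leaf is one. -/
def IsLeafVertex {t : AngleTree} : Vertex t → Prop
  | none => True
  | some p => p.IsLeaf

/-- The parent of a vertex. -/
def Pos.parent : {t : AngleTree} → Pos t → Vertex t
  | _, .top _ => none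
  | _, .left p => some (match p.parent with
      | none => .top _
      | some q => .left q)
  | _, .right p => some (match p.parent with
      | none => .top _
      | some q => .right q)

/-- The edge `e` is incident to the vertex `v`. -/
def Incident {t : AngleTree} (e : Pos t) (v : Vertex t) : Prop := v = some e ∨ v = e.parent

/-- The lambda-lengths of the edges, given that of the root edge: around an inner vertex the
lambda-lengths are proportional to the sines of the opposite angles. -/
def Pos.lam : {t : AngleTree} → Pos t → ℝ → ℝ
  | _, .top _, x => x
  | node α β _ _, .left p, x => p.lam (x * (sin β / sin (2 * π - α - β)))
  | node α β _ _, .right p, x => p.lam (x * (sin α / sin (2 * π - α - β)))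

/-- The label `ℓ(e)` of an edge, defined by `λ(e) = √(2 exp ℓ(e))` and normalized by `ℓ = 0` (that
is, `λ = √2`) on the root edge. -/
def Pos.label {t : AngleTree} (e : Pos t) : ℝ := log ((e.lam (√2)) ^ 2 / 2)

/-! ## The contour -/

/-- The vertices visited, one per unit of time, by the contour of the part above the root edge. -/
def upperContour : (t : AngleTree) → List (Pos t)
  | leaf => [.top _]
  | node _ _ l r =>
      .top _ :: (l.upperContour.map .left ++ .top _ :: (r.upperContour.map .right ++ [.top _]))

/-- The vertices visited by the contour at the times `0, 1, …, 4n - 6`, starting and ending at the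
root leaf. -/
def contour (t : AngleTree) : List (Vertex t) :=
  none :: (t.upperContour.map some ++ [none])

/-- The edges followed by the contour during the time intervals `(k, k + 1)`,
`k = 0, 1, …, 4n - 7`. -/
def contourEdges : (t : AngleTree) → List (Pos t)
  | leaf => [.top _, .top _]
  | node _ _ l r =>
      .top _ :: (l.contourEdges.map .left ++ r.contourEdges.map .right ++ [.top _])

/-- The vertex visited at time `x`, for an integer time `x` in `[0, 4n - 6]`. -/
def vertexAt (t : AngleTree) (x : ℝ) : Vertex t := t.contour[⌊x⌋₊]?.getD none

/-- The edge visited at time `x`, for a non-integer time `x` in `[0, 4n - 6]`. -/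
def edgeAt (t : AngleTree) (x : ℝ) : Pos t := t.contourEdges[⌊x⌋₊]?.getD (.top t)

/-- The contour visits a leaf at time `x`. -/
def VisitsLeaf (t : AngleTree) (x : ℝ) : Prop :=
  ∃ k : ℕ, x = k ∧ k < t.contour.length ∧ IsLeafVertex (t.vertexAt x)

open Classical in
/-- The label process on `[0, 4n - 6]`: the label of the edge that is being visited. When the
contour is at a vertex `v`, it is the label of the edge `c v`, where `c` chooses an edge incident to
each vertex. -/
def contourLabel (t : AngleTree) (c : Vertex t → Pos t) (x : ℝ) : ℝ :=
  if x = ⌊x⌋₊ then (c (t.vertexAt x)).label else (t.edgeAt x).label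

end AngleTree

/-- The pseudo-distance `D°_Z(s, t) = Z_s + Z_t - 2 m_Z(s, t)` on `[0, 1]`, where `m_Z(s, t)` is the
larger one of the minima of `Z` over `[s ∧ t, s ∨ t]` and over `[0, s ∧ t] ∪ [s ∨ t, 1]`. (The
minima exist if `Z` is continuous and also if `Z` takes finitely many values.) -/
def dCirc (Z : ℝ → ℝ) (s t : ℝ) : ℝ :=
  Z s + Z t - 2 * max (sInf (Z '' Set.Icc (min s t) (max s t)))
    (sInf (Z '' (Set.Icc 0 (min s t) ∪ Set.Icc (max s t) 1)))

/-! ## Gluing ideal triangles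

Every ideal triangle is isometric to the one with vertices `0`, `1`, `∞` in the upper half-plane.
Its sides are parametrized by arc length, at unit speed. For an inner vertex with lambda-lengths
`λ_p` (edge to the parent), `λ_l` (left child), `λ_r` (right child), the side `(0, 1)` is dual to the
edge to the parent, `(0, ∞)` to the left edge, `(∞, 1)` to the right edge. The three horocycles
(Euclidean diameters `d₀`, `d₁` at `0` and `1`, height `H` at `∞`) with these lambda-lengths
satisfy `1 / (d₀ d₁) = λ_p² / 2`, `H / d₀ = λ_l² / 2`, `H / d₁ = λ_r² / 2`; hence the points of the
sides at the same signed distance from the two horocycles at their ends are `i λ_r / λ_p` on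
`(0, ∞)`, `1 + i λ_l / λ_p` on `(1, ∞)`, and the image of `i λ_r / λ_l` under `z ↦ z / (z + 1)` on
`(0, 1)`. Those midpoints are the points with parameter `0`, and they only depend on the ratios of
the lambda-lengths. Two sides dual to the same edge are glued so that the horocycles at their
ends match, that is, midpoint to midpoint, with the two triangles on different sides.

At a leaf, the triangle has two equal decorations at `0` and `1`, its third vertex `∞` is the puncture
of the leaf, and the sides `(0, ∞)` and `(1, ∞)` are glued by `z ↦ z + 1`. -/

/-- The ideal hyperbolic triangle with vertices `0`, `1`, `∞`. -/
def idealTriangle : Set ℍ := {z | 0 ≤ z.re ∧ z.re ≤ 1 ∧ 1 / 2 ≤ ‖(z : ℂ) - 1 / 2‖}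

/-- Arc length parametrization of the side from `0` to `∞`, starting from `i m` at `s = 0`. -/
def leftSide (m s : ℝ) : ℂ := ⟨0, m * exp s⟩

/-- Arc length parametrization of the side from `∞` to `1`, starting from `1 + i m` at `s = 0`. -/
def rightSide (m s : ℝ) : ℂ := ⟨1, m * exp (-s)⟩

/-- Arc length parametrization of the side from `0` to `1`: the image of `leftSide m` under the
isometry `z ↦ z / (z + 1)`. -/
def bottomSide (m s : ℝ) : ℂ := leftSide m s / (leftSide m s + 1)

namespace AngleTree

/-- Midpoint parameter, on the side dual to the root edge, of the triangle at the upper end of the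
root edge. It is `λ_r / λ_l` for an inner vertex. -/
def bottomMid : AngleTree → ℝ
  | leaf => 1
  | node α β _ _ => sin α / sin β

/-- The side identifications among the triangles of the vertices other than the root leaf:
`Glued t p z q w` says that the point `z` of the triangle at `p` is glued to the point `w` of the
triangle at `q`. -/
inductive Glued : (t : AngleTree) → Pos t → idealTriangle → Pos t → idealTriangle → Prop
  | fold (s : ℝ) (z w : idealTriangle)
      (hz : (z.1 : ℂ) = leftSide 1 s) (hw : (w.1 : ℂ) = rightSide 1 (-s)) :
      Glued leaf (.top _) z (.top _) w
  | leftEdge (α β : ℝ) (l r : AngleTree) (s : ℝ) (z w : idealTriangle)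
      (hz : (z.1 : ℂ) = leftSide (sin α / sin (2 * π - α - β)) s)
      (hw : (w.1 : ℂ) = bottomSide l.bottomMid s) :
      Glued (node α β l r) (.top _) z (.left (.top l)) w
  | rightEdge (α β : ℝ) (l r : AngleTree) (s : ℝ) (z w : idealTriangle)
      (hz : (z.1 : ℂ) = rightSide (sin β / sin (2 * π - α - β)) s)
      (hw : (w.1 : ℂ) = bottomSide r.bottomMid s) :
      Glued (node α β l r) (.top _) z (.right (.top r)) w
  | inLeft (α β : ℝ) (l r : AngleTree) (p q : Pos l) (z w : idealTriangle)
      (h : Glued l p z q w) : Glued (node α β l r) (.left p) z (.left q) w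
  | inRight (α β : ℝ) (l r : AngleTree) (p q : Pos r) (z w : idealTriangle)
      (h : Glued r p z q w) : Glued (node α β l r) (.right p) z (.right q) w

/-- All side identifications: those of `Glued`, the folding of the triangle at the root leaf, and
the identification along the root edge. -/
inductive SurfaceGlued (t : AngleTree) :
    Vertex t → idealTriangle → Vertex t → idealTriangle → Prop
  | rootFold (s : ℝ) (z w : idealTriangle)
      (hz : (z.1 : ℂ) = leftSide 1 s) (hw : (w.1 : ℂ) = rightSide 1 (-s)) :
      SurfaceGlued t none z none w
  | rootEdge (s : ℝ) (z w : idealTriangle)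
      (hz : (z.1 : ℂ) = bottomSide 1 (-s)) (hw : (w.1 : ℂ) = bottomSide t.bottomMid s) :
      SurfaceGlued t none z (some (.top t)) w
  | upper (p q : Pos t) (z w : idealTriangle) (h : Glued t p z q w) :
      SurfaceGlued t (some p) z (some q) w

/-- `HasChain t u z v w L`: there is a chain of total length `L` from the point `z` of the triangle
at `u` to the point `w` of the triangle at `v`, made of moves inside the triangles, whose length is
the hyperbolic distance, and of jumps of length `0` between points that are glued together. -/
inductive HasChain (t : AngleTree) :
    Vertex t → idealTriangle → Vertex t → idealTriangle → ℝ → Prop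
  | move (v : Vertex t) (z w : idealTriangle) : HasChain t v z v w (dist z.1 w.1)
  | jump (u v : Vertex t) (z w : idealTriangle) (h : SurfaceGlued t u z v w) :
      HasChain t u z v w 0
  | symm (u v : Vertex t) (z w : idealTriangle) (L : ℝ) (h : HasChain t u z v w L) :
      HasChain t v w u z L
  | trans (u v x : Vertex t) (z w y : idealTriangle) (L M : ℝ) (h₁ : HasChain t u z v w L)
      (h₂ : HasChain t v w x y M) : HasChain t u z x y (L + M)

theorem HasChain.nonneg {t : AngleTree} {u v : Vertex t} {z w : idealTriangle} {L : ℝ}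
    (h : HasChain t u z v w L) : 0 ≤ L := by
  induction h with
  | move v z w => exact dist_nonneg
  | jump => exact le_rfl
  | symm _ _ _ _ _ _ ih => exact ih
  | trans _ _ _ _ _ _ _ _ _ _ ih₁ ih₂ => exact add_nonneg ih₁ ih₂

theorem exists_leftSide {m : ℝ} (hm : 0 < m) (s : ℝ) :
    ∃ z : idealTriangle, (z.1 : ℂ) = leftSide m s := by
  have h : 0 < m * exp s := mul_pos hm (exp_pos s)
  refine ⟨⟨⟨leftSide m s, h⟩, le_refl (0 : ℝ), zero_le_one, ?_⟩, rfl⟩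
  have := Complex.abs_re_le_norm (leftSide m s - 1 / 2)
  simpa [leftSide] using this

theorem exists_rightSide {m : ℝ} (hm : 0 < m) (s : ℝ) :
    ∃ z : idealTriangle, (z.1 : ℂ) = rightSide m s := by
  have h : 0 < m * exp (-s) := mul_pos hm (exp_pos _)
  refine ⟨⟨⟨rightSide m s, h⟩, zero_le_one, le_refl (1 : ℝ), ?_⟩, rfl⟩
  have := Complex.abs_re_le_norm (rightSide m s - 1 / 2)
  refine le_trans (le_of_eq ?_) this
  norm_num [rightSide]

theorem exists_bottomSide {m : ℝ} (hm : 0 < m) (s : ℝ) :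
    ∃ z : idealTriangle, (z.1 : ℂ) = bottomSide m s := by
  obtain ⟨y, hy, e⟩ : ∃ y : ℝ, 0 < y ∧ leftSide m s = ⟨0, y⟩ :=
    ⟨m * exp s, mul_pos hm (exp_pos s), rfl⟩
  have hre : (bottomSide m s).re = y ^ 2 / (1 + y ^ 2) := by
    simp [bottomSide, e, Complex.div_re, Complex.normSq_apply, pow_two]
  have him : (bottomSide m s).im = y / (1 + y ^ 2) := by
    simp [bottomSide, e, Complex.div_im, Complex.normSq_apply, pow_two]
  have hpos : 0 < 1 + y ^ 2 := by positivity
  refine ⟨⟨⟨bottomSide m s, by rw [him]; positivity⟩, ?_, ?_, ?_⟩, rfl⟩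
  · change 0 ≤ (bottomSide m s).re
    rw [hre]; positivity
  · change (bottomSide m s).re ≤ 1
    rw [hre, div_le_one hpos]; linarith
  · change 1 / 2 ≤ ‖bottomSide m s - 1 / 2‖
    refine abs_le_of_sq_le_sq' (a := 1 / 2) ?_ (norm_nonneg _) |>.2
    rw [← Complex.normSq_eq_norm_sq, Complex.normSq_apply]
    have h1 : (bottomSide m s - 1 / 2).re = y ^ 2 / (1 + y ^ 2) - 1 / 2 := by
      rw [Complex.sub_re, hre]; norm_num
    have h2 : (bottomSide m s - 1 / 2).im = y / (1 + y ^ 2) := by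
      rw [Complex.sub_im, him]; norm_num
    rw [h1, h2]
    apply le_of_eq
    field_simp
    ring

theorem Allowed.bottomMid_pos : {t : AngleTree} → t.Allowed → 0 < t.bottomMid
  | leaf, _ => one_pos
  | node _ _ _ _, h => div_pos (sin_pos_of_mem_Ioo h.1) (sin_pos_of_mem_Ioo h.2.1)

theorem exists_hasChain_upper (T : AngleTree) : (t : AngleTree) → t.Allowed →
    (ι : Pos t → Pos T) →
    (∀ p q z w, Glued t p z q w → Glued T (ι p) z (ι q) w) → ∀ (p : Pos t) (z w : idealTriangle),
      ∃ L, HasChain T (some (ι (.top t))) z (some (ι p)) w L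
  | t, _, ι, _, .top _, z, w => ⟨_, .move _ z w⟩
  | node α β l r, h, ι, hι, .left p, z, w => by
      obtain ⟨a, ha⟩ := exists_leftSide (div_pos (sin_pos_of_mem_Ioo h.1)
        (sin_pos_of_mem_Ioo h.2.2.1)) 0
      obtain ⟨b, hb⟩ := exists_bottomSide h.2.2.2.2.2.1.bottomMid_pos 0
      obtain ⟨L, hL⟩ := exists_hasChain_upper T l h.2.2.2.2.2.1 (fun q => ι (.left q))
        (fun q q' x y hq => hι _ _ _ _ (.inLeft _ _ _ _ _ _ _ _ hq)) p b w
      exact ⟨_, .trans _ _ _ _ _ _ _ _ (.move _ z a) (.trans _ _ _ _ _ _ _ _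
        (.jump _ _ _ _ (.upper _ _ _ _ (hι _ _ _ _ (.leftEdge _ _ _ _ 0 a b ha hb)))) hL)⟩
  | node α β l r, h, ι, hι, .right p, z, w => by
      obtain ⟨a, ha⟩ := exists_rightSide (div_pos (sin_pos_of_mem_Ioo h.2.1)
        (sin_pos_of_mem_Ioo h.2.2.1)) 0
      obtain ⟨b, hb⟩ := exists_bottomSide h.2.2.2.2.2.2.bottomMid_pos 0
      obtain ⟨L, hL⟩ := exists_hasChain_upper T r h.2.2.2.2.2.2 (fun q => ι (.right q))
        (fun q q' x y hq => hι _ _ _ _ (.inRight _ _ _ _ _ _ _ _ hq)) p b w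
      exact ⟨_, .trans _ _ _ _ _ _ _ _ (.move _ z a) (.trans _ _ _ _ _ _ _ _
        (.jump _ _ _ _ (.upper _ _ _ _ (hι _ _ _ _ (.rightEdge _ _ _ _ 0 a b ha hb)))) hL)⟩

theorem exists_hasChain {t : AngleTree} (ht : t.Allowed) (u v : Vertex t) (z w : idealTriangle) :
    ∃ L, HasChain t u z v w L := by
  obtain ⟨b, hb⟩ := exists_bottomSide ht.bottomMid_pos 0
  have key : ∀ (v : Vertex t) (w : idealTriangle), ∃ L, HasChain t (some (.top t)) b v w L := by
    rintro (_ | p) w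
    · obtain ⟨a, ha⟩ := exists_bottomSide one_pos (-0)
      exact ⟨_, .trans _ _ _ _ _ _ _ _ (.symm _ _ _ _ _ (.jump _ _ _ _ (.rootEdge 0 a b ha hb)))
        (.move _ a w)⟩
    · exact exists_hasChain_upper t t ht id (fun _ _ _ _ h => h) p b w
  obtain ⟨L, hL⟩ := key u z
  obtain ⟨M, hM⟩ := key v w
  exact ⟨_, .trans _ _ _ _ _ _ _ _ (.symm _ _ _ _ _ hL) hM⟩

end AngleTree

/-- A plane binary tree with `n` leaves, rooted on a leaf, with an allowed angle assignment. -/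
structure RedTree (n : ℕ) where
  tree : AngleTree
  numLeaves_eq : tree.numLeaves = n
  allowed : tree.Allowed

namespace RedTree

variable {n : ℕ}

/-- The points of the disjoint union of the triangles attached to the vertices of the tree. -/
structure Piece (T : RedTree n) where
  vertex : T.tree.Vertex
  point : idealTriangle

/-- The quotient pseudo-distance: the infimum of the lengths of the chains. -/
instance (T : RedTree n) : PseudoMetricSpace T.Piece where
  dist x y := sInf {L | T.tree.HasChain x.vertex x.point y.vertex y.point L}
  dist_self x := le_antisymm
    (csInf_le ⟨0, fun _ h => h.nonneg⟩ (by
      have := AngleTree.HasChain.move x.vertex x.point x.point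
      rwa [dist_self] at this))
    (Real.sInf_nonneg fun _ h => h.nonneg)
  dist_comm x y := congrArg sInf (Set.ext fun _ => ⟨.symm _ _ _ _ _, .symm _ _ _ _ _⟩)
  dist_triangle x y z := by
    refine le_of_forall_pos_le_add fun ε hε => ?_
    obtain ⟨L, hL, hL'⟩ := Real.lt_sInf_add_pos
      (AngleTree.exists_hasChain T.allowed x.vertex y.vertex x.point y.point) (half_pos hε)
    obtain ⟨M, hM, hM'⟩ := Real.lt_sInf_add_pos
      (AngleTree.exists_hasChain T.allowed y.vertex z.vertex y.point z.point) (half_pos hε)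
    have := csInf_le ⟨0, fun _ h => h.nonneg⟩
      (show L + M ∈ {L | T.tree.HasChain x.vertex x.point z.vertex z.point L} from
        .trans _ _ _ _ _ _ _ _ hL hM)
    change L < sInf {L | T.tree.HasChain x.vertex x.point y.vertex y.point L} + ε / 2 at hL'
    change M < sInf {L | T.tree.HasChain y.vertex y.point z.vertex z.point L} + ε / 2 at hM'
    linarith

/-- The hyperbolic surface obtained by gluing the triangles, with its hyperbolic distance `dist`
(as a gluing of geodesic spaces along geodesics, its quotient distance is the length distance of
the glued hyperbolic metric). -/
def Glue (T : RedTree n) : Type := SeparationQuotient T.Piece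

instance (T : RedTree n) : MetricSpace T.Glue :=
  inferInstanceAs (MetricSpace (SeparationQuotient T.Piece))

/-- The closed horocycle neighborhood of length `ε`, `0 < ε ≤ 1`, of the puncture of a leaf `v`. The
puncture is the vertex `∞` of the triangle at `v`, whose vertical sides are glued by `z ↦ z + 1`, so
that the horocycle at height `1 / ε` has length `ε`. -/
def horocycleNhd (T : RedTree n) (ε : ℝ) (v : T.tree.Vertex) : Set T.Glue :=
  SeparationQuotient.mk '' {x : T.Piece | x.vertex = v ∧ 1 / ε ≤ x.point.1.im}

/-- The canonical horocycle neighborhood of the puncture of a leaf `v`: the one of length `1`. -/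
def canonicalHorocycle (T : RedTree n) (v : T.tree.Vertex) : Set T.Glue := T.horocycleNhd 1 v

/-- The rescaled and sped-up label process on `[0, 1]`. -/
def Z (T : RedTree n) (c : T.tree.Vertex → T.tree.Pos) (s : ℝ) : ℝ :=
  T.tree.contourLabel c (s * (4 * n - 6)) / (n : ℝ) ^ (1 / 4 : ℝ)

/-- The rescaled hyperbolic distance (infimum of the distances between points of the two sets)
between the canonical horocycles of the leaves visited at the rescaled times `s` and `t`. -/
def D (T : RedTree n) (s t : ℝ) : ℝ :=
  sInf (Set.image2 dist (T.canonicalHorocycle (T.tree.vertexAt (s * (4 * n - 6))))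
    (T.canonicalHorocycle (T.tree.vertexAt (t * (4 * n - 6))))) / (n : ℝ) ^ (1 / 4 : ℝ)

end RedTree

end

/-! ## Distances in the ideal triangle -/

/-! Every edge is dual to a geodesic running from the origin cusp to itself, and the contour of the
tree turns once around this cusp: two consecutive sides of edges bound one corner of a triangle (two
corners at a leaf). Two leaves are joined by a path that enters the cusp along the edge of the first
leaf, turns along a deep horocycle, and comes out along the edge of the second.

In a corner between edges of lambda-lengths `x` and `y`, opposite to an edge of lambda-length `z`,
the horocyclic arc is proportional to `z / (x y)`. Since `z ≤ x + y` (`sin_le_sin_add_sin`), it is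
at most the sum of one contribution per edge, namely `exp (-depth)`. This is `isChain_close_visits`;
`close_root` closes the chain into a loop.

Let `m` be a lower bound of the labels along an arc of the contour. At height `exp κ` with `κ = log
n - m / 2`, every `exp (-depth)` is at most `1 / n`, so that fewer than `4n` corners cost at most
`8`. Reaching this height from a leaf with label `ℓ` costs `log 2 + log n + (ℓ - m) / 2`
(`dist_apex_edgePoint_le`). The two leaves together give the bound, as `8 + 2 log 2 ≤ 10`.
`D_le_of_le` applies this to the arc with the larger infimum. -/

/-- Follows from the formula for `sinh (dist z w / 2)` and `x ≤ sinh x`. In the uses below the two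
points share a horocycle and `y` is the length of the arc between them. -/
theorem UpperHalfPlane.dist_le_of_sq_le {z w : ℍ} {y : ℝ} (hy : 0 ≤ y)
    (h : (z.re - w.re) ^ 2 + (z.im - w.im) ^ 2 ≤ y ^ 2 * (z.im * w.im)) : dist z w ≤ y := by
  have h0 : 0 < z.im * w.im := mul_pos z.im_pos w.im_pos
  have h1 : dist z w / 2 ≤ Real.sinh (dist z w / 2) := Real.self_le_sinh_iff.2 (by positivity)
  have h2 : dist (z : ℂ) w ≤ y * √(z.im * w.im) := by
    rw [Complex.dist_eq_re_im]
    refine Real.sqrt_le_iff.2 ⟨by positivity, ?_⟩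
    rw [mul_pow, Real.sq_sqrt h0.le]
    exact h
  rw [UpperHalfPlane.sinh_half_dist] at h1
  have h3 : dist (z : ℂ) w / (2 * √(z.im * w.im)) ≤ y / 2 := by
    rw [div_le_div_iff₀ (by positivity) two_pos]
    linarith
  linarith

theorem bottomSide_re_im {m s y : ℝ} (h : m * exp s = y) :
    (bottomSide m s).re = y ^ 2 / (1 + y ^ 2) ∧ (bottomSide m s).im = y / (1 + y ^ 2) := by
  constructor
  · simp [bottomSide, leftSide, h, Complex.div_re, Complex.normSq_apply, pow_two]
  · simp [bottomSide, leftSide, h, Complex.div_im, Complex.normSq_apply, pow_two]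

/-- Both points lie on the horocycle at `0` of Euclidean diameter `y`; `z ↦ -1 / z` turns the arc
into a horizontal segment of length `1` at height `1 / y`. The next two lemmas treat the corners at
`1` and `∞`. -/
theorem dist_bottomSide_leftSide_le {z w : ℍ} {m s m' s' y : ℝ} (hz : (z : ℂ) = bottomSide m s)
    (hw : (w : ℂ) = leftSide m' s') (hy : 0 < y) (h : m * exp s = y) (h' : m' * exp s' = y) :
    dist z w ≤ y := by
  obtain ⟨h1, h2⟩ := bottomSide_re_im h
  rw [← hz] at h1 h2
  have h3 : w.re = 0 := congrArg Complex.re hw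
  have h4 : w.im = y := (congrArg Complex.im hw).trans h'
  refine UpperHalfPlane.dist_le_of_sq_le hy.le (le_of_eq ?_)
  rw [show z.re = _ from h1, show z.im = _ from h2, h3, h4]
  field_simp
  ring

theorem dist_bottomSide_rightSide_le {z w : ℍ} {m s m' s' y : ℝ} (hz : (z : ℂ) = bottomSide m s)
    (hw : (w : ℂ) = rightSide m' s') (hy : 0 < y) (h : m * exp s = y⁻¹)
    (h' : m' * exp (-s') = y) : dist z w ≤ y := by
  obtain ⟨h1, h2⟩ := bottomSide_re_im h
  rw [← hz] at h1 h2
  have h3 : w.re = 1 := congrArg Complex.re hw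
  have h4 : w.im = y := (congrArg Complex.im hw).trans h'
  refine UpperHalfPlane.dist_le_of_sq_le hy.le (le_of_eq ?_)
  rw [show z.re = _ from h1, show z.im = _ from h2, h3, h4]
  field_simp
  ring

theorem dist_leftSide_rightSide_le {z w : ℍ} {m s m' s' y : ℝ} (hz : (z : ℂ) = leftSide m s)
    (hw : (w : ℂ) = rightSide m' s') (hy : 0 < y) (h : m * exp s = y⁻¹)
    (h' : m' * exp (-s') = y⁻¹) : dist z w ≤ y := by
  have h1 : z.re = 0 := congrArg Complex.re hz
  have h2 : z.im = y⁻¹ := (congrArg Complex.im hz).trans h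
  have h3 : w.re = 1 := congrArg Complex.re hw
  have h4 : w.im = y⁻¹ := (congrArg Complex.im hw).trans h'
  refine UpperHalfPlane.dist_le_of_sq_le hy.le (le_of_eq ?_)
  rw [h1, h2, h3, h4]
  field_simp
  ring

theorem dist_bottomSide_le {z w : ℍ} {m s s' : ℝ} (hm : 0 < m) (hz : (z : ℂ) = bottomSide m s)
    (hw : (w : ℂ) = bottomSide m s') : dist z w ≤ |s - s'| := by
  obtain ⟨h1, h2⟩ := bottomSide_re_im (m := m) (s := s) rfl
  obtain ⟨h3, h4⟩ := bottomSide_re_im (m := m) (s := s') rfl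
  rw [← hz] at h1 h2
  rw [← hw] at h3 h4
  have h5 : Real.cosh (dist z w) ≤ Real.cosh (s - s') := by
    rw [UpperHalfPlane.cosh_dist, Complex.dist_eq_re_im, Real.sq_sqrt (by positivity), h1, h2, h3,
      h4, show z.im = _ from h2, show w.im = _ from h4, Real.cosh_eq, neg_sub, Real.exp_sub,
      Real.exp_sub]
    have := exp_pos s
    have := exp_pos s'
    apply le_of_eq
    field_simp
    ring
  simpa using Real.cosh_le_cosh.1 h5

/-- The triangle inequality for lambda-lengths: `sin a = -(sin b cos c + cos b sin c)` and cosines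
are at least `-1`. -/
theorem sin_le_sin_add_sin {a b c : ℝ} (hb : b ∈ Set.Ioo 0 π) (hc : c ∈ Set.Ioo 0 π)
    (h : a + b + c = 2 * π) : sin a ≤ sin b + sin c := by
  have hb' := sin_pos_of_mem_Ioo hb
  have hc' := sin_pos_of_mem_Ioo hc
  rw [show a = 2 * π - (b + c) by linarith, Real.sin_two_pi_sub, Real.sin_add]
  nlinarith [Real.neg_one_le_cos b, Real.neg_one_le_cos c]

noncomputable section

/-- The point of the bottom side of the ideal triangle with parameter `s`. -/
def bottomPoint (m s : ℝ) : idealTriangle :=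
  -- Choice makes the point a total function of `m`; it is meaningful for `0 < m`.
  @Classical.epsilon _ ⟨(AngleTree.exists_bottomSide one_pos 0).choose⟩
    fun z => (z.1 : ℂ) = bottomSide m s

theorem coe_bottomPoint {m : ℝ} (hm : 0 < m) (s : ℝ) :
    ((bottomPoint m s).1 : ℂ) = bottomSide m s :=
  Classical.epsilon_spec (AngleTree.exists_bottomSide hm s)

/-- The point of the ideal triangle at height `1` with real part `1 / 2`. -/
def apexPoint : idealTriangle :=
  ⟨⟨⟨1 / 2, 1⟩, one_pos⟩, by
    refine ⟨by norm_num, by norm_num, ?_⟩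
    have := Complex.abs_im_le_norm ((⟨1 / 2, 1⟩ : ℂ) - 1 / 2)
    norm_num at this
    norm_num
    linarith⟩

theorem dist_apexPoint_bottomPoint_le (s : ℝ) :
    dist apexPoint.1 (bottomPoint 1 s).1 ≤ log 2 + |s| := by
  have h := coe_bottomPoint one_pos 0
  have h1 : dist (bottomPoint 1 0).1 (bottomPoint 1 s).1 ≤ |s| := by
    simpa using dist_bottomSide_le one_pos h (coe_bottomPoint one_pos s)
  obtain ⟨h2, h3⟩ := bottomSide_re_im (m := 1) (s := 0) (y := 1) (by simp)
  rw [← h] at h2 h3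
  -- The midpoint `(1 + i) / 2` lies vertically below the apex `1 / 2 + i`.
  have h4 : dist apexPoint.1 (bottomPoint 1 0).1 = log 2 := by
    rw [UpperHalfPlane.dist_of_re_eq (by
      rw [show (bottomPoint 1 0).1.re = _ from h2]; change (1 / 2 : ℝ) = _; norm_num),
      show (bottomPoint 1 0).1.im = _ from h3, show apexPoint.1.im = 1 from rfl, Real.dist_eq]
    norm_num
    rw [one_div, Real.log_inv, abs_neg, abs_of_pos (Real.log_pos one_lt_two)]
  linarith [dist_triangle apexPoint.1 (bottomPoint 1 0).1 (bottomPoint 1 s).1]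

end

/-! ## Edges and contour of a tree -/

namespace AngleTree

theorem finite_pos : (t : AngleTree) → Finite t.Pos
  | leaf => Finite.of_surjective (fun _ : Unit => Pos.top leaf) fun p => by
      cases p; exact ⟨(), rfl⟩
  | node α β l r => by
      have := finite_pos l
      have := finite_pos r
      refine Finite.of_surjective (α := Unit ⊕ l.Pos ⊕ r.Pos)
        (Sum.elim (fun _ => .top _) (Sum.elim .left .right)) fun p => ?_
      cases p with
      | top => exact ⟨.inl (), rfl⟩
      | left p => exact ⟨.inr (.inl p), rfl⟩
      | right p => exact ⟨.inr (.inr p), rfl⟩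

instance (t : AngleTree) : Finite t.Pos := finite_pos t

/-- The parameter `bottomMid` of the subtree above the edge `p`. -/
noncomputable def Pos.mid : {t : AngleTree} → Pos t → ℝ
  | t, .top _ => t.bottomMid
  | _, .left p => p.mid
  | _, .right p => p.mid

theorem Allowed.mid_pos : {t : AngleTree} → t.Allowed → (p : t.Pos) → 0 < p.mid
  | _, h, .top _ => h.bottomMid_pos
  | node _ _ _ _, h, .left p => Allowed.mid_pos h.2.2.2.2.2.1 p
  | node _ _ _ _, h, .right p => Allowed.mid_pos h.2.2.2.2.2.2 p

theorem Allowed.lam_pos : {t : AngleTree} → t.Allowed → (p : t.Pos) → {x : ℝ} → 0 < x → 0 < p.lam x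
  | _, _, .top _, _, hx => hx
  | node _ _ _ _, h, .left p, _, hx => Allowed.lam_pos h.2.2.2.2.2.1 p
      (mul_pos hx (div_pos (sin_pos_of_mem_Ioo h.2.1) (sin_pos_of_mem_Ioo h.2.2.1)))
  | node _ _ _ _, h, .right p, _, hx => Allowed.lam_pos h.2.2.2.2.2.2 p
      (mul_pos hx (div_pos (sin_pos_of_mem_Ioo h.1) (sin_pos_of_mem_Ioo h.2.2.1)))

theorem Allowed.sqrt_two_mul_exp_label {t : AngleTree} (h : t.Allowed) (p : t.Pos) :
    √2 * exp (p.label / 2) = p.lam (√2) := by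
  have h0 := h.lam_pos p (Real.sqrt_pos.2 two_pos)
  have h1 : p.label / 2 = log (p.lam (√2) / √2) := by
    rw [Pos.label, show p.lam (√2) ^ 2 / 2 = (p.lam (√2) / √2) ^ 2 by
      rw [div_pow, Real.sq_sqrt zero_le_two], Real.log_pow]
    push_cast
    ring
  rw [h1, Real.exp_log (by positivity)]
  field_simp

theorem Pos.IsLeaf.mid_eq : {t : AngleTree} → {p : t.Pos} → p.IsLeaf → p.mid = 1
  | leaf, .top _, _ => rfl
  | _, .left p, h => Pos.IsLeaf.mid_eq (p := p) h
  | _, .right p, h => Pos.IsLeaf.mid_eq (p := p) h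

theorem Pos.not_isLeaf_of_parent_eq : {t : AngleTree} → {p q : t.Pos} → p.parent = some q →
    ¬ q.IsLeaf
  | _, .top _, _, h => by simp [Pos.parent] at h
  | _, .left p, q, h => by
      simp only [Pos.parent, Option.some.injEq] at h
      cases hp : p.parent with
      | none => rw [hp] at h; subst h; exact id
      | some q' => rw [hp] at h; subst h; exact (show ¬ q'.IsLeaf from Pos.not_isLeaf_of_parent_eq hp)
  | _, .right p, q, h => by
      simp only [Pos.parent, Option.some.injEq] at h
      cases hp : p.parent with
      | none => rw [hp] at h; subst h; exact id
      | some q' => rw [hp] at h; subst h; exact (show ¬ q'.IsLeaf from Pos.not_isLeaf_of_parent_eq hp)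

theorem Incident.eq_of_isLeaf {t : AngleTree} {p q : t.Pos} (h : Incident p (some q))
    (hq : q.IsLeaf) : p = q := by
  rcases h with h | h
  · exact (Option.some.inj h).symm
  · exact absurd hq (Pos.not_isLeaf_of_parent_eq h.symm)

theorem Incident.eq_top : {t : AngleTree} → {p : t.Pos} → Incident p none → p = .top t
  | _, .top _, _ => rfl
  | _, .left p, h => by simp [Incident, Pos.parent] at h
  | _, .right p, h => by simp [Incident, Pos.parent] at h

/-- A leaf has a single incident edge, so the arbitrary choice of labels at vertices has no effect
there. -/
theorem Incident.eq_of_isLeafVertex {t : AngleTree} {p q : t.Pos} {v : t.Vertex}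
    (hp : Incident p v) (hq : Incident q v) (hv : IsLeafVertex v) : p = q := by
  cases v with
  | none => rw [hp.eq_top, hq.eq_top]
  | some v => rw [hp.eq_of_isLeaf hv, hq.eq_of_isLeaf hv]

theorem incident_top (t : AngleTree) : Incident (.top t) none := Or.inr (by simp [Pos.parent])

/-! ### Contour combinatorics: sides of edges and visits to leaves. -/

/-- The edges followed by the contour, together with the information whether the edge is followed
upwards. -/
def visits : (t : AngleTree) → List (Pos t × Bool)
  | leaf => [(.top _, true), (.top _, false)]
  | node _ _ l r =>
      (.top _, true) :: (l.visits.map (Prod.map .left id) ++ r.visits.map (Prod.map .right id) ++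
        [(.top _, false)])

theorem map_fst_visits : (t : AngleTree) → t.visits.map Prod.fst = t.contourEdges
  | leaf => rfl
  | node _ _ l r => by
      simp [visits, contourEdges, ← map_fst_visits l, ← map_fst_visits r, Function.comp_def]

theorem length_visits : (t : AngleTree) → t.visits.length + 2 = 4 * t.upperLeaves
  | leaf => rfl
  | node _ _ l r => by
      have := length_visits l
      have := length_visits r
      simp only [visits, upperLeaves, List.length_cons, List.length_append, List.length_map,
        List.length_nil]
      omega

theorem length_contourEdges (t : AngleTree) : t.contourEdges.length + 2 = 4 * t.upperLeaves := by
  rw [← map_fst_visits, List.length_map, length_visits]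

theorem length_upperContour : (t : AngleTree) → t.upperContour.length + 3 = 4 * t.upperLeaves
  | leaf => rfl
  | node _ _ l r => by
      have := length_upperContour l
      have := length_upperContour r
      simp only [upperContour, upperLeaves, List.length_cons, List.length_append, List.length_map,
        List.length_nil]
      omega

theorem length_contour (t : AngleTree) : t.contour.length = t.contourEdges.length + 1 := by
  have := length_upperContour t
  have := length_contourEdges t
  simp only [contour, List.length_cons, List.length_append, List.length_map, List.length_nil]
  omega

theorem head?_visits (t : AngleTree) : t.visits.head? = some (.top t, true) := by
  cases t <;> rfl

theorem getLast?_visits (t : AngleTree) : t.visits.getLast? = some (.top t, false) := by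
  cases t with
  | leaf => rfl
  | node => rw [visits, ← List.cons_append, List.getLast?_concat]

/-- Entry `k` of `upperContour` is reached at time `k + 1`, so edges `k` and `k + 1` are those
followed just before and just after it; at a leaf the same edge is climbed and then descended. -/
theorem contourEdges_of_upperContour_isLeaf : (t : AngleTree) → {k : ℕ} → {p : t.Pos} →
    t.upperContour[k]? = some p → p.IsLeaf →
    t.contourEdges[k]? = some p ∧ t.contourEdges[k + 1]? = some p
  | leaf, k, p, h, _ => by
      cases k with
      | zero => simpa [upperContour, contourEdges] using h
      | succ k => simp [upperContour] at h
  | node α β l r, 0, p, h, hp => by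
      simp only [upperContour, List.getElem?_cons_zero, Option.some.injEq] at h
      subst h
      exact hp.elim
  | node α β l r, k + 1, p, h, hp => by
      have h1 := length_upperContour l
      have h2 := length_contourEdges l
      have h3 := length_upperContour r
      have h4 := length_contourEdges r
      simp only [upperContour, List.getElem?_cons_succ, List.getElem?_append, List.length_map,
        List.getElem?_map] at h
      split_ifs at h with hk
      · simp only [Option.map_eq_some_iff] at h
        obtain ⟨q, hq, rfl⟩ := h
        obtain ⟨h5, h6⟩ := contourEdges_of_upperContour_isLeaf l hq hp
        simp only [contourEdges, List.getElem?_cons_succ, List.append_assoc]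
        rw [List.getElem?_append_left (by simp; omega), List.getElem?_append_left (by simp; omega)]
        simp [h5, h6]
      · obtain ⟨j, rfl⟩ := Nat.exists_eq_add_of_le (not_lt.1 hk)
        rw [Nat.add_sub_cancel_left] at h
        cases j with
        | zero =>
          simp only [List.getElem?_cons_zero, Option.some.injEq] at h
          subst h
          exact hp.elim
        | succ j =>
          simp only [List.getElem?_cons_succ, List.getElem?_append, List.length_map,
            List.getElem?_map] at h
          split_ifs at h with hj
          · simp only [Option.map_eq_some_iff] at h
            obtain ⟨q, hq, rfl⟩ := h
            obtain ⟨h5, h6⟩ := contourEdges_of_upperContour_isLeaf r hq hp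
            simp only [contourEdges, List.getElem?_cons_succ, List.append_assoc]
            -- The vertex list of `l` is one shorter than its edge list; the visit to the branch
            -- point between the subtrees makes up for it.
            rw [show l.upperContour.length + (j + 1) = l.contourEdges.length + j by omega]
            constructor
            · rw [List.getElem?_append_right (by simp),
                List.getElem?_append_left (by simp; omega)]
              simp [h5]
            · rw [List.getElem?_append_right (by simp; omega),
                List.getElem?_append_left (by simp; omega)]
              simp [h6, show l.contourEdges.length + j + 1 - l.contourEdges.length = j + 1 by omega]
          · obtain ⟨i, rfl⟩ := Nat.exists_eq_add_of_le (not_lt.1 hj)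
            rw [Nat.add_sub_cancel_left] at h
            cases i with
            | zero =>
              simp only [List.getElem?_cons_zero, Option.some.injEq] at h
              subst h
              exact hp.elim
            | succ i => simp at h

/-- The edge followed by the contour during `(k, k + 1)`, and whether it is followed upwards. -/
def visitAt (t : AngleTree) (k : ℕ) : Pos t × Bool := t.visits[k]?.getD (.top t, true)

theorem fst_visitAt (t : AngleTree) (k : ℕ) :
    (t.visitAt k).1 = t.contourEdges[k]?.getD (.top t) := by
  rw [visitAt, ← map_fst_visits, List.getElem?_map]
  cases t.visits[k]? <;> rfl

theorem visitAt_zero (t : AngleTree) : t.visitAt 0 = (.top t, true) := by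
  rw [visitAt, ← List.head?_eq_getElem?, head?_visits]; rfl

theorem visitAt_length_sub_one (t : AngleTree) :
    t.visitAt (t.contourEdges.length - 1) = (.top t, false) := by
  rw [visitAt, ← map_fst_visits, List.length_map, ← List.getLast?_eq_getElem?, getLast?_visits]; rfl

theorem contour_getD_ends (t : AngleTree) :
    t.contour[0]?.getD none = none ∧ t.contour[t.contourEdges.length]?.getD none = none := by
  refine ⟨rfl, ?_⟩
  have h1 := length_upperContour t
  have h2 := length_contourEdges t
  rw [show t.contourEdges.length = t.upperContour.length + 1 by omega]
  simp [contour]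

/-- The edges followed before and after visiting a leaf are incident to it. -/
theorem incident_visitAt (t : AngleTree) {k : ℕ}
    (h : IsLeafVertex (t.contour[k]?.getD none)) :
    (k < t.contourEdges.length → Incident (t.visitAt k).1 (t.contour[k]?.getD none)) ∧
      (0 < k → k ≤ t.contourEdges.length →
        Incident (t.visitAt (k - 1)).1 (t.contour[k]?.getD none)) := by
  have h1 := length_upperContour t
  have h2 := length_contourEdges t
  obtain ⟨e1, e2⟩ := t.contour_getD_ends
  rcases Nat.eq_zero_or_pos k with rfl | hk
  · rw [e1, visitAt_zero]
    exact ⟨fun _ => t.incident_top, fun h => absurd h (lt_irrefl _)⟩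
  rcases lt_trichotomy k t.contourEdges.length with hk' | rfl | hk'
  · obtain ⟨j, rfl⟩ : ∃ j, k = j + 1 := ⟨k - 1, by omega⟩
    have hj : j < t.upperContour.length := by omega
    have e3 : t.contour[j + 1]?.getD none = some t.upperContour[j] := by
      simp [contour, List.getElem?_append, hj]
    rw [e3] at h ⊢
    obtain ⟨h5, h6⟩ := contourEdges_of_upperContour_isLeaf t (List.getElem?_eq_getElem hj) h
    rw [fst_visitAt, fst_visitAt, h6, Nat.add_sub_cancel, h5]
    exact ⟨fun _ => Or.inl rfl, fun _ _ => Or.inl rfl⟩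
  · rw [e2, visitAt_length_sub_one]
    exact ⟨fun h => absurd h (lt_irrefl _), fun _ _ => t.incident_top⟩
  · exact ⟨fun h => by omega, fun _ h => by omega⟩

end AngleTree

/-! ## Following the contour close to the origin -/

namespace RedTree

open AngleTree

variable {n : ℕ} (T : RedTree n)

theorem dist_le_of_hasChain {u v : T.tree.Vertex} {z w : idealTriangle} {L : ℝ}
    (h : T.tree.HasChain u z v w L) : dist (⟨u, z⟩ : T.Piece) ⟨v, w⟩ ≤ L :=
  csInf_le ⟨0, fun _ h => h.nonneg⟩ h

theorem dist_le_of_jump {u v : T.tree.Vertex} {z z' w : idealTriangle}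
    (h : T.tree.SurfaceGlued u z' v w) : dist (⟨u, z⟩ : T.Piece) ⟨v, w⟩ ≤ dist z.1 z'.1 := by
  simpa using T.dist_le_of_hasChain (.trans _ _ _ _ _ _ _ _ (.move u z z') (.jump _ _ _ _ h))

theorem dist_le_of_jump_jump {u v x : T.tree.Vertex} {z z' w w' : idealTriangle}
    (h : T.tree.SurfaceGlued x z' u z) (h' : T.tree.SurfaceGlued x w' v w) :
    dist (⟨u, z⟩ : T.Piece) ⟨v, w⟩ ≤ dist z'.1 w'.1 := by
  simpa using T.dist_le_of_hasChain (.trans _ _ _ _ _ _ _ _ (.symm _ _ _ _ _ (.jump _ _ _ _ h))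
    (.trans _ _ _ _ _ _ _ _ (.move x z' w') (.jump _ _ _ _ h')))

/-- Signed distance from the midpoint of an edge of a point at height `exp κ` above the horocycle
at the origin. -/
noncomputable def depth (κ : ℝ) (p : T.tree.Pos) : ℝ := κ + p.label / 2

/-- The point of an edge at height `exp κ` in the cusp of the origin. An edge has two such points:
the one visited when going up and the one visited when going down. -/
noncomputable def edgePoint (κ : ℝ) (u : T.tree.Pos × Bool) : T.Piece :=
  ⟨some u.1, bottomPoint u.1.mid (if u.2 then -T.depth κ u.1 else T.depth κ u.1)⟩

/-- The points of two consecutive edges are close to each other. -/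
def Close (κ : ℝ) (u v : T.tree.Pos × Bool) : Prop :=
  dist (T.edgePoint κ u) (T.edgePoint κ v) ≤ exp (-T.depth κ u.1) + exp (-T.depth κ v.1)

/-- Turning around a leaf crosses the two corners of its triangle at the origin. Each arc has length
`exp (-depth)`, and the arcs meet on the folded side. -/
theorem close_of_fold {κ : ℝ} {p : T.tree.Pos} (hp : p.mid = 1)
    (h : ∀ (s : ℝ) (z w : idealTriangle), (z.1 : ℂ) = leftSide 1 s → (w.1 : ℂ) = rightSide 1 (-s) →
      T.tree.SurfaceGlued (some p) z (some p) w) : T.Close κ (p, true) (p, false) := by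
  obtain ⟨z, hz⟩ := exists_leftSide one_pos (-T.depth κ p)
  obtain ⟨w, hw⟩ := exists_rightSide one_pos (-(-T.depth κ p))
  have h1 := dist_bottomSide_leftSide_le (coe_bottomPoint one_pos (-T.depth κ p)) hz
    (exp_pos (-T.depth κ p)) (by simp) (by simp)
  have h2 := dist_bottomSide_rightSide_le (coe_bottomPoint one_pos (T.depth κ p)) hw
    (exp_pos (-T.depth κ p)) (by simp [Real.exp_neg]) (by simp)
  refine (dist_triangle _ (⟨some p, w⟩ : T.Piece) _).trans (add_le_add ?_ ?_)
  · simp only [edgePoint, hp, if_true]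
    exact (T.dist_le_of_jump (h _ _ _ hz hw)).trans h1
  · rw [dist_comm]
    simp only [edgePoint, hp, Bool.false_eq_true, if_false]
    exact (T.dist_le_of_hasChain (.move _ _ _)).trans h2

/-- Induction over subtrees: `ι` embeds `t` into the whole tree and `x` is the lambda-length of its
root edge. At an inner vertex the three new links are the three corners of its triangle. -/
theorem isChain_close_visits (κ : ℝ) : (t : AngleTree) → t.Allowed → (x : ℝ) → 0 < x →
    (ι : t.Pos → T.tree.Pos) → (∀ p q z w, Glued t p z q w → Glued T.tree (ι p) z (ι q) w) →
    (∀ p, √2 * exp ((ι p).label / 2) = p.lam x) → (∀ p, (ι p).mid = p.mid) →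
    (t.visits.map (Prod.map ι id)).IsChain (T.Close κ)
  | leaf, _, x, _, ι, hglue, _, hmid => by
      simp only [visits, List.map_cons, List.map_nil, List.isChain_pair, Prod.map_apply, id]
      exact T.close_of_fold (hmid _) fun s z w hz hw => .upper _ _ _ _ (hglue _ _ _ _
        (.fold s z w hz hw))
  | node α β l r, h, x, hx, ι, hglue, hlab, hmid => by
      obtain ⟨hα, hβ, hγ, -, -, hl, hr⟩ := h
      have ha := sin_pos_of_mem_Ioo hα
      have hb := sin_pos_of_mem_Ioo hβ
      have hc := sin_pos_of_mem_Ioo hγ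
      have hab := sin_le_sin_add_sin hβ hγ (a := α) (by ring)
      have hba := sin_le_sin_add_sin hα hγ (a := β) (by ring)
      have hcab := sin_le_sin_add_sin hα hβ (a := 2 * π - α - β) (by ring)
      have ihl := isChain_close_visits κ l hl _ (mul_pos hx (div_pos hb hc)) (fun p => ι (.left p))
        (fun p q z w hg => hglue _ _ _ _ (.inLeft _ _ _ _ _ _ _ _ hg))
        (fun p => hlab (.left p)) (fun p => hmid (.left p))
      have ihr := isChain_close_visits κ r hr _ (mul_pos hx (div_pos ha hc)) (fun p => ι (.right p))
        (fun p q z w hg => hglue _ _ _ _ (.inRight _ _ _ _ _ _ _ _ hg))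
        (fun p => hlab (.right p)) (fun p => hmid (.right p))
      have gl : ∀ s z w, ((z : idealTriangle).1 : ℂ) =
          leftSide (sin α / sin (2 * π - α - β)) s →
          ((w : idealTriangle).1 : ℂ) = bottomSide l.bottomMid s →
          T.tree.SurfaceGlued (some (ι (.top _))) z (some (ι (.left (.top l)))) w :=
        fun s z w hz hw => .upper _ _ _ _ (hglue _ _ _ _ (.leftEdge _ _ _ _ s z w hz hw))
      have gr : ∀ s z w, ((z : idealTriangle).1 : ℂ) =
          rightSide (sin β / sin (2 * π - α - β)) s →
          ((w : idealTriangle).1 : ℂ) = bottomSide r.bottomMid s →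
          T.tree.SurfaceGlued (some (ι (.top _))) z (some (ι (.right (.top r)))) w :=
        fun s z w hz hw => .upper _ _ _ _ (hglue _ _ _ _ (.rightEdge _ _ _ _ s z w hz hw))
      have m0 : (ι (.top _)).mid = sin α / sin β := hmid _
      have ml : (ι (.left (.top l))).mid = l.bottomMid := hmid _
      have mr : (ι (.right (.top r))).mid = r.bottomMid := hmid _
      have e0 : √2 * exp ((ι (.top _)).label / 2) = x := hlab _
      -- `exp (depth)` is proportional to the lambda-length, so it obeys the same law of sines.
      have el : exp (T.depth κ (ι (.left (.top l)))) =
          exp (T.depth κ (ι (.top _))) * (sin β / sin (2 * π - α - β)) := by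
        have e1 : √2 * exp ((ι (.left (.top l))).label / 2) =
          x * (sin β / sin (2 * π - α - β)) := hlab _
        rw [← e0, mul_assoc] at e1
        rw [depth, depth, Real.exp_add, Real.exp_add,
          mul_left_cancel₀ (Real.sqrt_ne_zero'.2 two_pos) e1, mul_assoc]
      have er : exp (T.depth κ (ι (.right (.top r)))) =
          exp (T.depth κ (ι (.top _))) * (sin α / sin (2 * π - α - β)) := by
        have e1 : √2 * exp ((ι (.right (.top r))).label / 2) =
          x * (sin α / sin (2 * π - α - β)) := hlab _
        rw [← e0, mul_assoc] at e1
        rw [depth, depth, Real.exp_add, Real.exp_add,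
          mul_left_cancel₀ (Real.sqrt_ne_zero'.2 two_pos) e1, mul_assoc]
      have hbl := hl.bottomMid_pos
      have hbr := hr.bottomMid_pos
      have hA := exp_pos (T.depth κ (ι (.top _)))
      set d0 := T.depth κ (ι (.top _)) with hd0
      set dl := T.depth κ (ι (.left (.top l))) with hdl
      set dr := T.depth κ (ι (.right (.top r))) with hdr
      set a := sin α
      set b := sin β
      set c := sin (2 * π - α - β)
      -- Corner at `0`. Since horocycles match, both points have the same height there; the slack in
      -- the bound is a positive multiple of `b + c - a`.
      have c1 : T.Close κ (ι (.top _), true) (ι (.left (.top l)), true) := by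
        obtain ⟨z, hz⟩ := exists_leftSide (div_pos ha hc) (-dl)
        have hw := coe_bottomPoint hbl (-dl)
        have h1 := dist_bottomSide_leftSide_le (coe_bottomPoint (div_pos ha hb) (-d0)) hz
          (y := a / b * (exp d0)⁻¹) (by positivity) (by rw [Real.exp_neg])
          (by rw [Real.exp_neg, el]; field_simp)
        simp only [Close, edgePoint, m0, ml, if_true, ← hd0, ← hdl]
        refine ((T.dist_le_of_jump (gl _ _ _ hz hw)).trans h1).trans ?_
        rw [Real.exp_neg, Real.exp_neg, el, ← sub_nonneg]
        have : (exp d0)⁻¹ + (exp d0 * (b / c))⁻¹ - a / b * (exp d0)⁻¹ =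
          (b + c - a) / (b * exp d0) := by field_simp
        rw [this]
        exact div_nonneg (by linarith) (by positivity)
      -- Corner at `∞`: both points belong to the children's triangles, and the arc is run in the
      -- parent's.
      have c2 : T.Close κ (ι (.left (.top l)), false) (ι (.right (.top r)), true) := by
        obtain ⟨z, hz⟩ := exists_leftSide (div_pos ha hc) dl
        obtain ⟨z', hz'⟩ := exists_rightSide (div_pos hb hc) (-dr)
        have hw := coe_bottomPoint hbl dl
        have hw' := coe_bottomPoint hbr (-dr)
        have h1 := dist_leftSide_rightSide_le hz hz'
          (y := c ^ 2 / (a * b * exp d0)) (by positivity) (by rw [el]; field_simp)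
          (by rw [neg_neg, er]; field_simp)
        simp only [Close, edgePoint, mr, ml, if_true, ← hdr, ← hdl, Bool.false_eq_true, if_false]
        refine ((T.dist_le_of_jump_jump (gl _ _ _ hz hw) (gr _ _ _ hz' hw')).trans h1).trans ?_
        rw [Real.exp_neg, Real.exp_neg, el, er, ← sub_nonneg]
        have : (exp d0 * (b / c))⁻¹ + (exp d0 * (a / c))⁻¹ - c ^ 2 / (a * b * exp d0) =
          c * (a + b - c) / (a * b * exp d0) := by field_simp
        rw [this]
        exact div_nonneg (mul_nonneg hc.le (by linarith)) (by positivity)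
      -- Corner at `1`, symmetric to the corner at `0`.
      have c3 : T.Close κ (ι (.right (.top r)), false) (ι (.top _), false) := by
        obtain ⟨z, hz⟩ := exists_rightSide (div_pos hb hc) dr
        have hw := coe_bottomPoint hbr dr
        have h1 := dist_bottomSide_rightSide_le (coe_bottomPoint (div_pos ha hb) d0) hz
          (y := b / a * (exp d0)⁻¹) (by positivity) (by field_simp)
          (by rw [Real.exp_neg, er]; field_simp)
        simp only [Close, edgePoint, m0, mr, ← hd0, ← hdr, Bool.false_eq_true, if_false]
        rw [dist_comm]
        refine ((T.dist_le_of_jump (gr _ _ _ hz hw)).trans h1).trans ?_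
        rw [Real.exp_neg, Real.exp_neg, er, ← sub_nonneg]
        have : (exp d0 * (a / c))⁻¹ + (exp d0)⁻¹ - b / a * (exp d0)⁻¹ =
          (c + a - b) / (a * exp d0) := by field_simp
        rw [this]
        exact div_nonneg (by linarith) (by positivity)
      simp only [visits, List.map_cons, List.map_append, List.map_map, List.map_nil]
      have fl : (Prod.map ι id ∘ Prod.map Pos.left id : l.Pos × Bool → _) =
        Prod.map (fun p => ι (.left p)) id := rfl
      have fr : (Prod.map ι id ∘ Prod.map Pos.right id : r.Pos × Bool → _) =
        Prod.map (fun p => ι (.right p)) id := rfl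
      rw [fl, fr, List.isChain_cons, List.isChain_append, List.isChain_append]
      simp only [List.head?_append, List.getLast?_append, List.head?_map, List.getLast?_map,
        head?_visits, getLast?_visits, Option.map_some, Option.some_or, Prod.map_apply, id,
        List.head?_cons, Option.mem_def, Option.some.injEq, forall_eq']
      exact ⟨c1, ⟨ihl, ihr, c2⟩, List.isChain_singleton _, c3⟩

theorem close_visitAt (κ : ℝ) {k : ℕ} (hk : k + 1 < T.tree.contourEdges.length) :
    T.Close κ (T.tree.visitAt k) (T.tree.visitAt (k + 1)) := by
  have h := T.isChain_close_visits κ T.tree T.allowed (√2) (Real.sqrt_pos.2 two_pos) id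
    (fun _ _ _ _ h => h) T.allowed.sqrt_two_mul_exp_label (fun _ => rfl)
  rw [Prod.map_id, List.map_id, List.isChain_iff_getElem] at h
  rw [← map_fst_visits, List.length_map] at hk
  simpa [visitAt, List.getElem?_eq_getElem, hk, (Nat.lt_succ_self k).trans hk] using h k hk

/-- The turn around the root leaf. The root edge is glued with its parameter reversed, so the
descending point comes first, on the side of the vertex `0` of the root triangle. -/
theorem close_root (κ : ℝ) : T.Close κ (.top _, false) (.top _, true) := by
  set d := T.depth κ (.top T.tree) with hd
  have hm := T.allowed.bottomMid_pos
  obtain ⟨z, hz⟩ := exists_leftSide one_pos (-d)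
  obtain ⟨w, hw⟩ := exists_rightSide one_pos (-(-d))
  have h1 := dist_bottomSide_leftSide_le (coe_bottomPoint one_pos (-d)) hz
    (exp_pos (-d)) (by simp) (by simp)
  have h2 := dist_bottomSide_rightSide_le (coe_bottomPoint one_pos (-(-d))) hw
    (exp_pos (-d)) (by simp [Real.exp_neg]) (by simp)
  have g : ∀ s, T.tree.SurfaceGlued none (bottomPoint 1 (-s)) (some (.top _))
      (bottomPoint T.tree.bottomMid s) := fun s =>
    .rootEdge s _ _ (coe_bottomPoint one_pos _) (coe_bottomPoint hm _)
  have h3 := T.dist_le_of_hasChain (.trans _ _ _ _ _ _ _ _ (.symm _ _ _ _ _ (.jump _ _ _ _ (g d)))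
    (.trans _ _ _ _ _ _ _ _ (.move _ _ z) (.jump _ _ _ _ (.rootFold _ _ _ hz hw))))
  have h4 := T.dist_le_of_hasChain (.trans _ _ _ _ _ _ _ _ (.symm _ _ _ _ _
    (.jump _ _ _ _ (g (-d)))) (.move _ _ w))
  simp only [Close, edgePoint, ← hd, if_true, Bool.false_eq_true, if_false]
  refine (dist_triangle_right _ _ (⟨none, w⟩ : T.Piece)).trans (add_le_add ?_ ?_)
  · exact h3.trans (by linarith)
  · exact h4.trans (by linarith)

/-- The highest point of the triangle at a vertex. For a leaf, it lies on the boundary of the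
canonical horocycle neighborhood. -/
noncomputable def apex (v : T.tree.Vertex) : T.Piece := ⟨v, apexPoint⟩

/-- Descend from the horocycle to the midpoint of the edge, then follow the edge. -/
theorem dist_apex_edgePoint_le {v : T.tree.Vertex} (hv : IsLeafVertex v) (κ : ℝ)
    {u : T.tree.Pos × Bool} (hu : Incident u.1 v) :
    dist (T.apex v) (T.edgePoint κ u) ≤ log 2 + |T.depth κ u.1| := by
  obtain ⟨p, b⟩ := u
  set s := if b then -T.depth κ p else T.depth κ p with hs
  have habs : |s| = |T.depth κ p| := by rw [hs]; split_ifs <;> simp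
  cases v with
  | none =>
    obtain rfl := hu.eq_top
    refine (T.dist_le_of_jump (z' := bottomPoint 1 (-s)) (.rootEdge s _ _
      (coe_bottomPoint one_pos _) (coe_bottomPoint T.allowed.bottomMid_pos _))).trans ?_
    rw [← habs, ← abs_neg]
    exact dist_apexPoint_bottomPoint_le _
  | some q =>
    obtain rfl := hu.eq_of_isLeaf hv
    refine (T.dist_le_of_hasChain (.move _ _ _)).trans ?_
    rw [Pos.IsLeaf.mid_eq hv, ← habs]
    exact dist_apexPoint_bottomPoint_le _

theorem dist_edgePoint_visitAt_le (κ : ℝ) {δ : ℝ} {i j : ℕ} (hij : i ≤ j)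
    (hj : j < T.tree.contourEdges.length)
    (hδ : ∀ k, i ≤ k → k ≤ j → exp (-T.depth κ (T.tree.visitAt k).1) ≤ δ) :
    dist (T.edgePoint κ (T.tree.visitAt i)) (T.edgePoint κ (T.tree.visitAt j)) ≤
      (j - i) * (2 * δ) := by
  refine (dist_le_Ico_sum_of_dist_le (f := fun k => T.edgePoint κ (T.tree.visitAt k)) hij
    (d := fun _ => 2 * δ) fun {k} h1 h2 => ?_).trans (le_of_eq ?_)
  · have h3 := T.close_visitAt κ (k := k) (by omega)
    have h4 := hδ k h1 h2.le
    have h5 := hδ (k + 1) (by omega) h2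
    exact h3.trans (by linarith)
  · simp [Nat.cast_sub hij]

end RedTree

/-! ## The bound along an arc of the contour -/

namespace RedTree

open AngleTree

variable {n : ℕ} (T : RedTree n)

theorem length_contourEdges_add : T.tree.contourEdges.length + 6 = 4 * n := by
  have h1 := T.tree.length_contourEdges
  have h2 := T.numLeaves_eq
  rw [numLeaves] at h2
  omega

theorem cast_length_contourEdges : (T.tree.contourEdges.length : ℝ) = 4 * n - 6 := by
  have := congrArg (Nat.cast (R := ℝ)) T.length_contourEdges_add
  push_cast at this
  linarith

/-- The vertex visited by the contour at time `k`. -/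
def vertexNat (k : ℕ) : T.tree.Vertex := T.tree.contour[k]?.getD none

/-- The label of the edge followed by the contour during `(k, k + 1)`. -/
noncomputable def labelNat (k : ℕ) : ℝ := (T.tree.visitAt k).1.label

theorem exp_neg_depth_le (hn : 2 ≤ n) {m : ℝ} {k : ℕ} (hk : m ≤ T.labelNat k) :
    exp (-T.depth (log n - m / 2) (T.tree.visitAt k).1) ≤ (n : ℝ)⁻¹ := by
  have hn0 : (0 : ℝ) < n := by exact_mod_cast (by omega : 0 < n)
  rw [labelNat] at hk
  rw [← Real.exp_log hn0, ← Real.exp_neg, Real.exp_le_exp, depth, Real.exp_log hn0]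
  linarith

theorem dist_apex_le {u v : T.tree.Vertex} (hu : IsLeafVertex u)
    (hv : IsLeafVertex v) {k l : ℕ} (hk : Incident (T.tree.visitAt k).1 u)
    (hl : Incident (T.tree.visitAt l).1 v) {m : ℝ} (hmk : m ≤ T.labelNat k)
    (hml : m ≤ T.labelNat l)
    (h : dist (T.edgePoint (log n - m / 2) (T.tree.visitAt k))
      (T.edgePoint (log n - m / 2) (T.tree.visitAt l)) ≤ 8) :
    dist (T.apex u) (T.apex v) ≤
      (T.labelNat k + T.labelNat l - 2 * m) / 2 + (2 * log n + 10) := by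
  have hn1 : 0 ≤ log n := Real.log_natCast_nonneg n
  have h1 := T.dist_apex_edgePoint_le hu (log n - m / 2) hk
  have h2 := T.dist_apex_edgePoint_le hv (log n - m / 2) hl
  have h3 := dist_triangle4_right (T.apex u) (T.apex v)
    (T.edgePoint (log n - m / 2) (T.tree.visitAt k))
    (T.edgePoint (log n - m / 2) (T.tree.visitAt l))
  -- The constant `10` is `8` for the turn plus `2 log 2 < 2` for the two descents.
  have h4 := Real.log_two_lt_d9
  rw [labelNat] at hmk hml ⊢
  rw [labelNat]
  rw [abs_of_nonneg (by rw [depth]; linarith), depth] at h1 h2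
  linarith

/-- The bound along the arc from time `i` to time `j`. -/
theorem dist_apex_vertexNat_le (hn : 2 ≤ n) {i j : ℕ} (hij : i < j)
    (hj : j ≤ T.tree.contourEdges.length) (hi' : IsLeafVertex (T.vertexNat i))
    (hj' : IsLeafVertex (T.vertexNat j)) {m : ℝ} (hm : ∀ k, i ≤ k → k < j → m ≤ T.labelNat k) :
    dist (T.apex (T.vertexNat i)) (T.apex (T.vertexNat j)) ≤
      (T.labelNat i + T.labelNat (j - 1) - 2 * m) / 2 + (2 * log n + 10) := by
  refine T.dist_apex_le hi' hj' ((incident_visitAt _ hi').1 (by omega))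
    ((incident_visitAt _ hj').2 (by omega) hj) (hm _ le_rfl hij) (hm _ (by omega) (by omega)) ?_
  -- The last edge before time `j` has index `j - 1`; each of the fewer than `4n` steps costs at
  -- most `2 / n`.
  refine (T.dist_edgePoint_visitAt_le _ (i := i) (j := j - 1) (by omega) (by omega)
    fun k h1 h2 => T.exp_neg_depth_le hn (hm k h1 (by omega))).trans ?_
  have h3 : (j : ℝ) ≤ 4 * n - 6 := by rw [← T.cast_length_contourEdges]; exact_mod_cast hj
  have hn0 : (0 : ℝ) < n := by exact_mod_cast (by omega : 0 < n)
  have h4 : (0 : ℝ) ≤ i := Nat.cast_nonneg i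
  rw [Nat.cast_sub (by omega), Nat.cast_one, ← div_eq_mul_inv, ← mul_div_assoc, div_le_iff₀ hn0]
  linarith

/-- The bound along the arc from time `j` to time `i` that goes through the root leaf. -/
theorem dist_apex_vertexNat_le_of_root (hn : 2 ≤ n) {i j : ℕ} (hi : 0 < i) (hij : i < j)
    (hj : j < T.tree.contourEdges.length) (hi' : IsLeafVertex (T.vertexNat i))
    (hj' : IsLeafVertex (T.vertexNat j)) {m : ℝ} (hm : ∀ k, k < i → m ≤ T.labelNat k)
    (hm' : ∀ k, j ≤ k → k < T.tree.contourEdges.length → m ≤ T.labelNat k) :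
    dist (T.apex (T.vertexNat i)) (T.apex (T.vertexNat j)) ≤
      (T.labelNat (i - 1) + T.labelNat j - 2 * m) / 2 + (2 * log n + 10) := by
  refine T.dist_apex_le hi' hj' ((incident_visitAt _ hi').2 hi (by omega))
    ((incident_visitAt _ hj').1 hj) (hm _ (by omega)) (hm' _ le_rfl hj) ?_
  set κ := log n - m / 2
  have h1 := T.dist_edgePoint_visitAt_le κ (i := 0) (j := i - 1) (by omega) (by omega)
    fun k h1 h2 => T.exp_neg_depth_le hn (hm k (by omega))
  have h2 := T.dist_edgePoint_visitAt_le κ (i := j) (j := T.tree.contourEdges.length - 1)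
    (by omega) (by omega) fun k h1 h2 => T.exp_neg_depth_le hn (hm' k h1 (by omega))
  -- One more step joins the last edge of the contour to the first.
  have h3 : T.Close κ _ _ := T.close_root κ
  rw [← T.tree.visitAt_zero, ← T.tree.visitAt_length_sub_one] at h3
  have h4 : exp (-T.depth κ _) ≤ _ := T.exp_neg_depth_le hn (hm 0 hi)
  have h5 : exp (-T.depth κ _) ≤ _ :=
    T.exp_neg_depth_le hn (hm' (T.tree.contourEdges.length - 1) (by omega) (by omega))
  have h6 := dist_triangle4 (T.edgePoint κ (T.tree.visitAt j))
    (T.edgePoint κ (T.tree.visitAt (T.tree.contourEdges.length - 1)))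
    (T.edgePoint κ (T.tree.visitAt 0)) (T.edgePoint κ (T.tree.visitAt (i - 1)))
  rw [dist_comm]
  rw [Nat.cast_sub (by omega), T.cast_length_contourEdges] at h2
  rw [Nat.cast_sub hi] at h1
  rw [Close] at h3
  have h7 : (i : ℝ) ≤ j := by exact_mod_cast hij.le
  have hn0 : (0 : ℝ) < n := by exact_mod_cast (by omega : 0 < n)
  have h8 : (n : ℝ) * (n : ℝ)⁻¹ = 1 := mul_inv_cancel₀ hn0.ne'
  have h9 : 0 ≤ (j - i : ℝ) * (n : ℝ)⁻¹ := mul_nonneg (by linarith) (by positivity)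
  have h10 : 0 < (n : ℝ)⁻¹ := by positivity
  push_cast at h1 h2
  linarith

/-! ## The rescaled processes -/

theorem D_le_dist_apex (s t : ℝ) :
    T.D s t ≤ dist (T.apex (T.tree.vertexAt (s * (4 * n - 6))))
      (T.apex (T.tree.vertexAt (t * (4 * n - 6)))) / (n : ℝ) ^ (1 / 4 : ℝ) := by
  refine div_le_div_of_nonneg_right (csInf_le ⟨0, ?_⟩ ?_) (by positivity)
  · rintro _ ⟨_, _, _, _, rfl⟩
    exact dist_nonneg
  · exact ⟨SeparationQuotient.mk (T.apex _), ⟨_, ⟨rfl, by simp [apex, apexPoint]⟩, rfl⟩,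
      SeparationQuotient.mk (T.apex _), ⟨_, ⟨rfl, by simp [apex, apexPoint]⟩, rfl⟩, rfl⟩

theorem D_comm (s t : ℝ) : T.D s t = T.D t s := by
  rw [D, D, Set.image2_swap]
  simp only [dist_comm]

/-- The process takes finitely many values, so each `sInf` in `dCirc` is a true lower bound. -/
theorem bddBelow_Z_image (c : T.tree.Vertex → T.tree.Pos) (S : Set ℝ) : BddBelow (T.Z c '' S) := by
  refine ((Set.finite_range fun p : T.tree.Pos => p.label / (n : ℝ) ^ (1 / 4 : ℝ)).subset
    ?_).bddBelow
  rintro _ ⟨s, -, rfl⟩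
  simp only [Z, contourLabel]
  split_ifs
  · exact ⟨_, rfl⟩
  · exact ⟨_, rfl⟩

theorem Z_of_eq_natCast (c : T.tree.Vertex → T.tree.Pos) {s : ℝ} {k : ℕ}
    (h : s * (4 * n - 6) = k) :
    T.Z c s = (c (T.vertexNat k)).label / (n : ℝ) ^ (1 / 4 : ℝ) := by
  rw [Z, h, contourLabel, if_pos (by simp), vertexAt, Nat.floor_natCast, vertexNat]

theorem Z_of_mem_Ioo (c : T.tree.Vertex → T.tree.Pos) {s : ℝ} {k : ℕ}
    (h : s * (4 * n - 6) = k + 1 / 2) : T.Z c s = T.labelNat k / (n : ℝ) ^ (1 / 4 : ℝ) := by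
  have hk : ⌊(k + 1 / 2 : ℝ)⌋₊ = k := by
    rw [Nat.floor_eq_iff (by positivity)]
    constructor <;> linarith
  rw [Z, h, contourLabel, hk, if_neg (by norm_num), edgeAt, hk, labelNat, fst_visitAt]

theorem label_eq_labelNat {c : T.tree.Vertex → T.tree.Pos} (hc : ∀ v, Incident (c v) v) {k l : ℕ}
    (hk : IsLeafVertex (T.vertexNat k)) (h : Incident (T.tree.visitAt l).1 (T.vertexNat k)) :
    (c (T.vertexNat k)).label = T.labelNat l := by
  rw [labelNat, (hc _).eq_of_isLeafVertex h hk]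

theorem vertexNat_zero : T.vertexNat 0 = none := (contour_getD_ends _).1

theorem vertexNat_length : T.vertexNat T.tree.contourEdges.length = none := (contour_getD_ends _).2

theorem D_le_of_le (hn : 2 ≤ n) {c : T.tree.Vertex → T.tree.Pos} (hc : ∀ v, Incident (c v) v)
    {s t : ℝ} (hst : s ≤ t) (ht : t ≤ 1) (hs' : T.tree.VisitsLeaf (s * (4 * n - 6)))
    (ht' : T.tree.VisitsLeaf (t * (4 * n - 6))) :
    T.D s t ≤ 1 / 2 * dCirc (T.Z c) s t + (2 * Real.log n + 10) / (n : ℝ) ^ (1 / 4 : ℝ) := by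
  obtain ⟨i, hi, -, hi'⟩ := hs'
  obtain ⟨j, hj, -, hj'⟩ := ht'
  have hn0 : (2 : ℝ) ≤ n := by exact_mod_cast hn
  have hN : (0 : ℝ) < 4 * n - 6 := by linarith
  have hlog : 0 ≤ log n := Real.log_natCast_nonneg n
  refine (T.D_le_dist_apex s t).trans ?_
  have ei : T.tree.vertexAt (s * (4 * n - 6)) = T.vertexNat i := by
    rw [hi, vertexAt, Nat.floor_natCast, vertexNat]
  have ej : T.tree.vertexAt (t * (4 * n - 6)) = T.vertexNat j := by
    rw [hj, vertexAt, Nat.floor_natCast, vertexNat]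
  have hij : i ≤ j := by
    exact_mod_cast (by rw [← hi, ← hj]; gcongr : (i : ℝ) ≤ j)
  have hjN : j ≤ T.tree.contourEdges.length := by
    have : (j : ℝ) ≤ T.tree.contourEdges.length := by
      rw [← hj, T.cast_length_contourEdges]; nlinarith
    exact_mod_cast this
  rw [ei] at hi' ⊢
  rw [ej] at hj' ⊢
  have hq : 0 < (n : ℝ) ^ (1 / 4 : ℝ) := by positivity
  rw [dCirc, min_eq_left hst, max_eq_right hst, T.Z_of_eq_natCast c hi, T.Z_of_eq_natCast c hj]
  set q := (n : ℝ) ^ (1 / 4 : ℝ)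
  set I := sInf (T.Z c '' Set.Icc s t)
  set J := sInf (T.Z c '' (Set.Icc 0 s ∪ Set.Icc t 1))
  suffices h : dist (T.apex (T.vertexNat i)) (T.apex (T.vertexNat j)) ≤
      ((c (T.vertexNat i)).label + (c (T.vertexNat j)).label - 2 * (max I J * q)) / 2 +
        (2 * log n + 10) by
    refine (div_le_div_of_nonneg_right h hq.le).trans (le_of_eq ?_)
    field_simp
  -- Sampling at the half-integer time `k + 1 / 2` reads the label of the edge, away from the
  -- arbitrary values at vertices.
  have hI : ∀ k, i ≤ k → k < j → I * q ≤ T.labelNat k := fun k h1 h2 => by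
    rw [← le_div_iff₀ hq, ← T.Z_of_mem_Ioo c (s := (k + 1 / 2) / (4 * n - 6)) (by field_simp)]
    refine csInf_le (T.bddBelow_Z_image c _) (Set.mem_image_of_mem _ ⟨?_, ?_⟩)
    · rw [le_div_iff₀ hN, hi]
      have : (i : ℝ) ≤ k := by exact_mod_cast h1
      linarith
    · rw [div_le_iff₀ hN, hj]
      have : (k : ℝ) + 1 ≤ j := by exact_mod_cast h2
      linarith
  have hJ : ∀ k, k < i → J * q ≤ T.labelNat k := fun k h1 => by
    rw [← le_div_iff₀ hq, ← T.Z_of_mem_Ioo c (s := (k + 1 / 2) / (4 * n - 6)) (by field_simp)]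
    refine csInf_le (T.bddBelow_Z_image c _) (Set.mem_image_of_mem _ (Or.inl ⟨by positivity, ?_⟩))
    rw [div_le_iff₀ hN, hi]
    have : (k : ℝ) + 1 ≤ i := by exact_mod_cast h1
    linarith
  have hJ' : ∀ k, j ≤ k → k < T.tree.contourEdges.length → J * q ≤ T.labelNat k :=
    fun k h1 h2 => by
      rw [← le_div_iff₀ hq, ← T.Z_of_mem_Ioo c (s := (k + 1 / 2) / (4 * n - 6)) (by field_simp)]
      refine csInf_le (T.bddBelow_Z_image c _) (Set.mem_image_of_mem _ (Or.inr ⟨?_, ?_⟩))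
      · rw [le_div_iff₀ hN, hj]
        have : (j : ℝ) ≤ k := by exact_mod_cast h1
        linarith
      · rw [div_le_iff₀ hN, ← T.cast_length_contourEdges]
        have : (k : ℝ) + 1 ≤ T.tree.contourEdges.length := by exact_mod_cast h2
        linarith
  -- When both times visit the same leaf (possibly the root at both ends of the contour), only
  -- nonnegativity of the bound is needed.
  by_cases hv : T.vertexNat i = T.vertexNat j
  · rw [hv, dist_self]
    have h1 : max I J ≤ (c (T.vertexNat j)).label / q := by
      rw [← T.Z_of_eq_natCast c hj]
      exact max_le (csInf_le (T.bddBelow_Z_image c _) ⟨t, ⟨hst, le_rfl⟩, rfl⟩)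
        (csInf_le (T.bddBelow_Z_image c _) ⟨t, Or.inr ⟨le_rfl, ht⟩, rfl⟩)
    rw [le_div_iff₀ hq] at h1
    linarith
  have hij' : i < j := lt_of_le_of_ne hij fun h => hv (by rw [h])
  rcases max_choice I J with h | h <;> rw [h]
  · rw [T.label_eq_labelNat hc hi' ((incident_visitAt _ hi').1 (by omega)),
      T.label_eq_labelNat hc hj' ((incident_visitAt _ hj').2 (by omega) hjN)]
    exact T.dist_apex_vertexNat_le hn hij' hjN hi' hj' hI
  -- For the outer arc, a time at the root is moved to the other end of the contour, which leaves a
  -- single interval of times.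
  rcases Nat.eq_zero_or_pos i with rfl | hi0
  · have hjN' : j < T.tree.contourEdges.length := lt_of_le_of_ne hjN fun h => hv (by
      rw [h, vertexNat_zero, vertexNat_length])
    have e : T.vertexNat 0 = T.vertexNat T.tree.contourEdges.length := by
      rw [vertexNat_zero, vertexNat_length]
    rw [e] at hi' ⊢
    rw [T.label_eq_labelNat hc hi' ((incident_visitAt _ hi').2 (by omega) le_rfl),
      T.label_eq_labelNat hc hj' ((incident_visitAt _ hj').1 hjN'), dist_comm,
      add_comm (T.labelNat _)]
    exact T.dist_apex_vertexNat_le hn hjN' le_rfl hj' hi' hJ'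
  rcases hjN.eq_or_lt with rfl | hjN'
  · have e : T.vertexNat T.tree.contourEdges.length = T.vertexNat 0 := by
      rw [vertexNat_zero, vertexNat_length]
    rw [e] at hj' ⊢
    rw [T.label_eq_labelNat hc hi' ((incident_visitAt _ hi').2 (by omega) hij),
      T.label_eq_labelNat hc hj' ((incident_visitAt _ hj').1 (by omega)), dist_comm,
      add_comm (T.labelNat _)]
    exact T.dist_apex_vertexNat_le hn hi0 hij hj' hi' fun k _ hk => hJ k hk
  · rw [T.label_eq_labelNat hc hi' ((incident_visitAt _ hi').2 hi0 (by omega)),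
      T.label_eq_labelNat hc hj' ((incident_visitAt _ hj').1 hjN')]
    exact T.dist_apex_vertexNat_le_of_root hn hi0 hij' hjN' hi' hj' hJ hJ'

end RedTree

theorem dCirc_comm (Z : ℝ → ℝ) (s t : ℝ) : dCirc Z s t = dCirc Z t s := by
  rw [dCirc, dCirc, min_comm, max_comm s, add_comm (Z s)]

theorem mainTheorem12 (n : ℕ) (hn : 2 ≤ n) (T : RedTree n)
    (c : T.tree.Vertex → T.tree.Pos) (hc : ∀ v, AngleTree.Incident (c v) v)
    (s t : ℝ) (hs : s ∈ Set.Icc (0 : ℝ) 1) (ht : t ∈ Set.Icc (0 : ℝ) 1)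
    (hs' : T.tree.VisitsLeaf (s * (4 * n - 6))) (ht' : T.tree.VisitsLeaf (t * (4 * n - 6))) :
    T.D s t ≤ 1 / 2 * dCirc (T.Z c) s t + (2 * Real.log n + 10) / (n : ℝ) ^ (1 / 4 : ℝ) := by
  rcases le_total s t with h | h
  · exact T.D_le_of_le hn hc h ht.2 hs' ht'
  · rw [T.D_comm, dCirc_comm]
    exact T.D_le_of_le hn hc h hs.2 ht' hs'
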